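/- A graph is a space homeomorphic to a connected one-dimensional polyhedron, that is, to the underlying space of a finite simplicial complex in a Euclidean space which is connected, has at least one $1$-simplex and has no simplices of dimension greater than $1$. For a compact metrizable space $X$ let $C(X,X)$ be the space of all continuous maps $X\to X$ with the topology of uniform convergence. A map $f\in C(X,X)$ is called zero-dimensional if every fiber $f^{-1}(y)$, $y\in X$, has covering dimension at most $0$. The class 0-$DIM$ consists of all compact metrizable spaces $X$ such that the set of zero-dimensional maps is a dense $G_\delta$ subset of $C(X,X)$. **Theorem 8.3.** If $X=G_1\times\dots\times G_n$ is a product of finitely many graphs $G_1,\dots,G_n$, then $X$ belongs to 0-$DIM$. -/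

import Mathlib

/-- Lebesgue covering dimension at most `n`: every finite open cover of `X` has a finite open
refinement covering `X` such that each point lies in at most `n + 1` of its members. -/
def CoveringDimLE (X : Type*) [TopologicalSpace X] (n : ℕ) : Prop :=
  ∀ U : Set (Set X), U.Finite → (∀ u ∈ U, IsOpen u) → ⋃₀ U = Set.univ →
    ∃ V : Set (Set X), V.Finite ∧ (∀ v ∈ V, IsOpen v) ∧ ⋃₀ V = Set.univ ∧
      (∀ v ∈ V, ∃ u ∈ U, v ⊆ u) ∧ ∀ x : X, {v ∈ V | x ∈ v}.encard ≤ n + 1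

/-- `f` is an `n`-dimensional map: every fiber has covering dimension at most `n`. -/
def IsDimensionalMap {X Y : Type*} [TopologicalSpace X] [TopologicalSpace Y]
    (n : ℕ) (f : C(X, Y)) : Prop :=
  ∀ y : Y, CoveringDimLE (f ⁻¹' {y}) n

/-- The class 0-DIM of compact metrizable spaces `X` such that the zero-dimensional maps form a
dense `G_δ` set in `C(X, X)`. The topology on `C(X, X)` is the compact-open one, which for compact
`X` is the topology of uniform convergence for any metric inducing the topology of `X`. -/
structure ZeroDIM (X : Type*) [TopologicalSpace X] : Prop where
  compact : CompactSpace X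
  metrizable : TopologicalSpace.MetrizableSpace X
  isGδ : IsGδ {f : C(X, X) | IsDimensionalMap 0 f}
  dense : Dense {f : C(X, X) | IsDimensionalMap 0 f}

/-- A graph: a space homeomorphic to a connected one-dimensional polyhedron, i.e. to the
underlying space of a finite simplicial complex in a Euclidean space, all of whose simplices have
dimension at most one and which has at least one simplex of dimension one. -/
def IsGraphSpace (X : Type*) [TopologicalSpace X] : Prop :=
  ∃ (N : ℕ) (K : Geometry.SimplicialComplex ℝ (EuclideanSpace ℝ (Fin N))),
    K.faces.Finite ∧ (∀ s ∈ K.faces, s.card ≤ 2) ∧ (∃ s ∈ K.faces, s.card = 2) ∧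
      IsConnected K.space ∧ Nonempty (X ≃ₜ K.space)

/-! Zero-dimensionality of fibers is tested on countably many pairs of basic open sets with disjoint
closures, and by compactness each test is an open condition on the map; this gives the `G_δ`. For
density it suffices to approximate `f` by maps with finite fibers. Halving edges gives each graph a
global parameter in `[0, 1]`: `0` at vertices, `1` at midpoints. A real function close to a
stretched parameter of the coordinate `f i` folds back to a map near `f i` (`exists_lift`), and on
each fiber of that map it takes at most three values. So real functions `u i` whose joint fibers are
finite are enough. Take `u i` to be a Lipschitz approximation plus a tiny, steep zigzag in the
coordinate `x i`: two points in one joint fiber and on the same linear pieces coincide, since the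
zigzag outruns the Lipschitz part in the coordinate where they differ most
(`exists_finite_fibers_near`). -/

open Set Topology TopologicalSpace

/-! ### Zero-dimensional fibers and the `G_δ` property -/

section ZeroDimensional

/-- A compact totally disconnected Hausdorff space has covering dimension at most zero. -/
theorem coveringDimLE_zero_of_totallyDisconnected {A : Type*} [TopologicalSpace A] [CompactSpace A]
    [T2Space A] [TotallyDisconnectedSpace A] : CoveringDimLE A 0 := by
  intro U _ hUo hUc
  have hcov : IsOpenCover (fun u : U => (⟨u, hUo u u.2⟩ : Opens A)) := by
    refine IsOpenCover.mk ?_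
    ext x
    have : x ∈ ⋃₀ U := hUc ▸ mem_univ x
    simpa using this
  obtain ⟨n, W, hW, hWc, hWd⟩ := hcov.exists_finite_nonempty_disjoint_clopen_cover
  refine ⟨range fun j => (W j : Set A), finite_range _, ?_, ?_, ?_, ?_⟩
  · rintro _ ⟨j, rfl⟩
    exact (W j).isClopen.isOpen
  · rw [sUnion_range]
    exact univ_subset_iff.1 hWc
  · rintro _ ⟨j, rfl⟩
    obtain ⟨i, hi⟩ := (hW j).2
    exact ⟨i, i.2, hi⟩
  · intro x
    have hs : {v ∈ range fun j => (W j : Set A) | x ∈ v}.Subsingleton := by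
      rintro _ ⟨⟨i, rfl⟩, hi⟩ _ ⟨⟨j, rfl⟩, hj⟩
      by_contra hne
      have hij : i ≠ j := fun h => hne (by rw [h])
      exact disjoint_left.1 (Clopens.coe_disjoint.2 (hWd hij)) hi hj
    simpa using encard_le_one_iff_subsingleton.2 hs

/-- In a space of covering dimension zero, disjoint closed sets are separated by a clopen set. -/
theorem CoveringDimLE.exists_isClopen_separating {A : Type*} [TopologicalSpace A]
    (hA : CoveringDimLE A 0) {K L : Set A} (hK : IsClosed K) (hL : IsClosed L)
    (hKL : Disjoint K L) : ∃ C : Set A, IsClopen C ∧ K ⊆ C ∧ Disjoint C L := by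
  obtain ⟨V, -, hVo, hVc, hVr, hV1⟩ := hA {Kᶜ, Lᶜ} (by simp)
    (by rintro u (rfl | rfl); exacts [hK.isOpen_compl, hL.isOpen_compl])
    (by rw [sUnion_pair, ← compl_inter, hKL.inter_eq, compl_empty])
  have huniq : ∀ {v w x}, v ∈ V → w ∈ V → x ∈ v → x ∈ w → v = w := by
    intro v w x hv hw hxv hxw
    have := hV1 x
    rw [Nat.cast_zero, zero_add, encard_le_one_iff_subsingleton] at this
    exact this ⟨hv, hxv⟩ ⟨hw, hxw⟩
  refine ⟨⋃₀ {v ∈ V | (v ∩ K).Nonempty}, ⟨?_, isOpen_sUnion fun v hv => hVo v hv.1⟩, ?_, ?_⟩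
  · have : (⋃₀ {v ∈ V | (v ∩ K).Nonempty})ᶜ = ⋃₀ {v ∈ V | ¬ (v ∩ K).Nonempty} := by
      ext x
      obtain ⟨v, hv, hxv⟩ : x ∈ ⋃₀ V := hVc ▸ mem_univ x
      constructor
      · intro hx
        exact ⟨v, ⟨hv, fun h => hx ⟨v, ⟨hv, h⟩, hxv⟩⟩, hxv⟩
      · rintro ⟨w, ⟨hw, hwK⟩, hxw⟩ ⟨w', ⟨hw', hwK'⟩, hxw'⟩
        exact hwK (huniq hw' hw hxw' hxw ▸ hwK')
    rw [← isOpen_compl_iff, this]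
    exact isOpen_sUnion fun v hv => hVo v hv.1
  · intro x hx
    obtain ⟨v, hv, hxv⟩ : x ∈ ⋃₀ V := hVc ▸ mem_univ x
    exact ⟨v, ⟨hv, x, hxv, hx⟩, hxv⟩
  · rw [disjoint_left]
    rintro x ⟨v, ⟨hv, y, hyv, hyK⟩, hxv⟩ hxL
    obtain ⟨u, rfl | rfl, hvu⟩ := hVr v hv
    exacts [hvu hyv hyK, hvu hxv hxL]

variable {X Y : Type*} [TopologicalSpace X] [TopologicalSpace Y]

/-- `A` can be split by disjoint open sets of the ambient space, one containing `K` and the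
other containing `L`. -/
def SplitBetween (K L A : Set X) : Prop :=
  ∃ O P : Set X, IsOpen O ∧ IsOpen P ∧ Disjoint O P ∧ K ⊆ O ∧ L ⊆ P ∧ A ⊆ O ∪ P

/-- A splitting by ambient open sets of the fiber over `y` also splits the fibers over a
neighborhood of `y`, for all maps near `f`. Finitely many such neighborhoods cover `Y`. -/
theorem isOpen_setOf_splitBetween_fiber [CompactSpace X] [CompactSpace Y] [T2Space Y]
    (K L : Set X) : IsOpen {f : C(X, Y) | ∀ y, SplitBetween K L (f ⁻¹' {y})} := by
  rw [isOpen_iff_mem_nhds]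
  intro f hf
  choose O P hO hP hd hK hL hs using hf
  -- The closure of `N` makes this a condition "compact set into open set", open in the compact-open
  -- topology.
  have key : ∀ y, ∃ N : Set Y, IsOpen N ∧ y ∈ N ∧ MapsTo f (O y ∪ P y)ᶜ (closure N)ᶜ := by
    intro y
    have hc : IsCompact (f '' (O y ∪ P y)ᶜ) :=
      (((hO y).union (hP y)).isClosed_compl.isCompact).image f.continuous
    have hy : y ∉ f '' (O y ∪ P y)ᶜ := by
      rintro ⟨x, hx, hxy⟩
      exact hx (hs y hxy)
    obtain ⟨N, hN, hNc, hNs⟩ := exists_mem_nhds_isClosed_subset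
      (hc.isClosed.isOpen_compl.mem_nhds hy)
    refine ⟨interior N, isOpen_interior, mem_interior_iff_mem_nhds.2 hN, fun x hx hxN => ?_⟩
    exact hNs (closure_minimal interior_subset hNc hxN) ⟨x, hx, rfl⟩
  choose N hNo hyN hN using key
  obtain ⟨t, ht⟩ := isCompact_univ.elim_finite_subcover N hNo fun y _ => mem_iUnion.2 ⟨y, hyN y⟩
  have hev : ∀ᶠ g : C(X, Y) in 𝓝 f, ∀ y ∈ t, MapsTo g (O y ∪ P y)ᶜ (closure (N y))ᶜ := by
    rw [Filter.eventually_all_finset]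
    exact fun y _ => ContinuousMap.eventually_mapsTo
      ((hO y).union (hP y)).isClosed_compl.isCompact isClosed_closure.isOpen_compl (hN y)
  filter_upwards [hev] with g hg y
  obtain ⟨z, hz, hyz⟩ := mem_iUnion₂.1 (ht (mem_univ y))
  refine ⟨O z, P z, hO z, hP z, hd z, hK z, hL z, fun x hx => ?_⟩
  by_contra hxn
  refine hg z hz hxn (subset_closure ?_)
  rw [mem_preimage, mem_singleton_iff] at hx
  rwa [hx]

/-- As `A` is closed, both halves of a clopen partition of `A` are closed in `X`; joined with `K`
and `L` they are separated by normality. -/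
theorem splitBetween_of_coveringDimLE [T2Space X] [CompactSpace X] {A K L : Set X}
    (hAc : IsClosed A) (hA : CoveringDimLE A 0) (hK : IsClosed K) (hL : IsClosed L)
    (hKL : Disjoint K L) : SplitBetween K L A := by
  obtain ⟨C, hC, hKC, hCL⟩ := hA.exists_isClopen_separating
    (hK.preimage continuous_subtype_val) (hL.preimage continuous_subtype_val)
    (hKL.preimage (Subtype.val : A → X))
  have h1 : IsClosed ((↑) '' C ∪ K : Set X) :=
    (hAc.isClosedEmbedding_subtypeVal.isClosedMap _ hC.1).union hK
  have h2 : IsClosed ((↑) '' Cᶜ ∪ L : Set X) :=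
    (hAc.isClosedEmbedding_subtypeVal.isClosedMap _ hC.compl.1).union hL
  have h12 : Disjoint ((↑) '' C ∪ K : Set X) ((↑) '' Cᶜ ∪ L) := by
    rw [disjoint_left]
    rintro _ (⟨x, hx, rfl⟩ | hx) (⟨y, hy, hxy⟩ | hy)
    · exact hy (Subtype.ext hxy ▸ hx)
    · exact disjoint_left.1 hCL hx hy
    · exact hy (hKC (by rw [mem_preimage, hxy]; exact hx))
    · exact disjoint_left.1 hKL hx hy
  obtain ⟨O, P, hO, hP, hO', hP', hd⟩ := normal_separation h1 h2 h12
  refine ⟨O, P, hO, hP, hd, subset_union_right.trans hO', subset_union_right.trans hP', ?_⟩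
  intro x hx
  by_cases hxC : (⟨x, hx⟩ : A) ∈ C
  · exact Or.inl (hO' (Or.inl ⟨_, hxC, rfl⟩))
  · exact Or.inr (hP' (Or.inl ⟨_, hxC, rfl⟩))

/-- The zero-dimensional maps between compact metrizable spaces form a `G_δ` set. -/
theorem isGδ_setOf_isDimensionalMap_zero [CompactSpace X] [T2Space X] [SecondCountableTopology X]
    [CompactSpace Y] [T2Space Y] : IsGδ {f : C(X, Y) | IsDimensionalMap 0 f} := by
  let B := countableBasis X
  have hB : IsTopologicalBasis B := isBasis_countableBasis X
  let S : Set (Set X × Set X) := {p ∈ B ×ˢ B | Disjoint (closure p.1) (closure p.2)}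
  have hS : S.Countable :=
    ((countable_countableBasis X).prod (countable_countableBasis X)).mono fun p hp => hp.1
  have : {f : C(X, Y) | IsDimensionalMap 0 f} = ⋂ p ∈ S,
      {f : C(X, Y) | ∀ y, SplitBetween (closure p.1) (closure p.2) (f ⁻¹' {y})} := by
    ext f
    simp only [mem_ofPred_eq, mem_iInter]
    constructor
    · intro hf p hp y
      exact splitBetween_of_coveringDimLE (isClosed_singleton.preimage f.continuous) (hf y)
        isClosed_closure isClosed_closure hp.2
    · intro hf y
      have hcl : IsClosed (f ⁻¹' {y}) := isClosed_singleton.preimage f.continuous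
      have : CompactSpace (f ⁻¹' {y}) := isCompact_iff_compactSpace.1 hcl.isCompact
      have : TotallySeparatedSpace (f ⁻¹' {y}) := by
        refine totallySeparatedSpace_iff_exists_isClopen.2 ?_
        intro a b hab
        obtain ⟨u, hau, hu, v, hbv, hv, huv⟩ :=
          exists_open_nhds_disjoint_closure (Subtype.coe_ne_coe.2 hab)
        obtain ⟨k, hkB, hak, hku⟩ := hB.exists_subset_of_mem_open hau hu
        obtain ⟨l, hlB, hbl, hlv⟩ := hB.exists_subset_of_mem_open hbv hv
        obtain ⟨O, P, hO, hP, hd, hkO, hlP, hs⟩ := hf (k, l)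
          ⟨⟨hkB, hlB⟩, huv.mono (closure_mono hku) (closure_mono hlv)⟩ y
        have hcompl : (Subtype.val ⁻¹' O : Set (f ⁻¹' {y}))ᶜ = Subtype.val ⁻¹' P := by
          ext x
          exact ⟨fun hx => (hs x.2).resolve_left hx, fun hx hx' => disjoint_left.1 hd hx' hx⟩
        refine ⟨Subtype.val ⁻¹' O, ⟨?_, hO.preimage continuous_subtype_val⟩,
          hkO (subset_closure hak), ?_⟩
        · rw [← isOpen_compl_iff, hcompl]
          exact hP.preimage continuous_subtype_val
        · rw [hcompl]
          exact hlP (subset_closure hbl)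
      exact coveringDimLE_zero_of_totallyDisconnected
  rw [this]
  exact IsGδ.biInter hS fun p _ => (isOpen_setOf_splitBetween_fiber _ _).isGδ

/-- A map with finite fibers is zero-dimensional. -/
theorem isDimensionalMap_zero_of_finite_fibers [T1Space X] (f : C(X, Y))
    (hf : ∀ y, (f ⁻¹' {y}).Finite) : IsDimensionalMap 0 f := by
  intro y
  have : Finite (f ⁻¹' {y}) := hf y
  exact coveringDimLE_zero_of_totallyDisconnected

end ZeroDimensional

/-! ### Graphs as unions of half edges -/

section ArcDecomposition

open scoped NNReal

/-- A decomposition of `G` into arcs `arc j '' [0, 1]` which meet one another only at endpoints,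
always at parameters both equal to `0` or both equal to `1`. -/
structure ArcDecomposition (G J : Type*) [PseudoMetricSpace G] where
  /-- the parametrizations of the arcs -/
  arc : J → ℝ → G
  /-- a common Lipschitz constant of the parametrizations -/
  const : ℝ≥0
  lipschitz : ∀ j, LipschitzWith const (arc j)
  surj : ∀ p, ∃ j, ∃ t ∈ Icc (0 : ℝ) 1, arc j t = p
  inj : ∀ {j k s t}, s ∈ Icc (0 : ℝ) 1 → t ∈ Icc (0 : ℝ) 1 → arc j s = arc k t →
    s = t ∧ (j = k ∨ s = 0 ∨ s = 1)

variable {E : Type*} [NormedAddCommGroup E] [NormedSpace ℝ E]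

/-- The space of a connected one-dimensional complex is the union of its edges. -/
theorem Geometry.SimplicialComplex.exists_edge_of_mem_space
    (K : Geometry.SimplicialComplex ℝ E) (hfin : K.faces.Finite) (hcard : ∀ s ∈ K.faces, s.card ≤ 2)
    (hedge : ∃ s ∈ K.faces, s.card = 2) (hconn : IsConnected K.space) {x : E} (hx : x ∈ K.space) :
    ∃ s ∈ K.faces, s.card = 2 ∧ x ∈ convexHull ℝ (s : Set E) := by
  -- `S` is the union of the edges and `T` the set of isolated vertices: disjoint closed sets, so
  -- connectedness rules out `T`.
  let S := ⋃ s ∈ {s ∈ K.faces | s.card = 2}, convexHull ℝ (s : Set E)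
  let T := ⋃ s ∈ {s ∈ K.faces | s.card = 1 ∧ ¬ (s : Set E) ⊆ S}, convexHull ℝ (s : Set E)
  have hS : IsClosed S := (hfin.subset (sep_subset _ _)).isClosed_biUnion fun s _ =>
    (s.finite_toSet.isCompact_convexHull ℝ).isClosed
  have hT : IsClosed T := (hfin.subset (sep_subset _ _)).isClosed_biUnion fun s _ =>
    (s.finite_toSet.isCompact_convexHull ℝ).isClosed
  have hcov : K.space ⊆ S ∪ T := by
    intro y hy
    obtain ⟨s, hs, hys⟩ := mem_space_iff.1 hy
    have h2 := hcard s hs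
    have h0 := (nonempty_of_mem_faces hs).card_pos
    obtain h1 | h1 : s.card = 2 ∨ s.card = 1 := by omega
    · exact Or.inl (mem_biUnion (show s ∈ {s ∈ K.faces | s.card = 2} from ⟨hs, h1⟩) hys)
    · by_cases hsS : (s : Set E) ⊆ S
      · obtain ⟨a, rfl⟩ := Finset.card_eq_one.1 h1
        simp only [Finset.coe_singleton, convexHull_singleton, mem_singleton_iff] at hys
        subst hys
        exact Or.inl (hsS (by simp))
      · exact Or.inr (mem_biUnion
          (show s ∈ {s ∈ K.faces | s.card = 1 ∧ ¬ (s : Set E) ⊆ S} from ⟨hs, h1, hsS⟩) hys)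
  have hST : ∀ y, y ∈ S → y ∈ T → False := by
    intro y hyS hyT
    simp only [T, mem_iUnion] at hyT
    obtain ⟨s, ⟨hs, h1, hsS⟩, hys⟩ := hyT
    obtain ⟨a, rfl⟩ := Finset.card_eq_one.1 h1
    simp only [Finset.coe_singleton, convexHull_singleton, mem_singleton_iff] at hys
    subst hys
    exact hsS (by simpa using hyS)
  have hsub : K.space ⊆ S := by
    refine (isPreconnected_iff_subset_of_disjoint_closed.1 hconn.isPreconnected S T hS hT hcov
      ?_).resolve_right ?_
    · ext y
      simp only [mem_inter_iff, mem_empty_iff_false, iff_false]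
      exact fun h => hST y h.2.1 h.2.2
    · intro h
      obtain ⟨s, hs, h2⟩ := hedge
      obtain ⟨y, hy⟩ := nonempty_of_mem_faces hs
      have hy' := subset_convexHull ℝ (s : Set E) hy
      exact hST y (mem_biUnion (show s ∈ {s ∈ K.faces | s.card = 2} from ⟨hs, h2⟩) hy')
        (h (convexHull_subset_space hs hy'))
  have := hsub hx
  simp only [S, mem_iUnion] at this
  obtain ⟨s, ⟨hs, h2⟩, hxs⟩ := this
  exact ⟨s, hs, h2, hxs⟩

/-- The point at parameter `t ∈ [0, 1]` on the half edge from `a` to the midpoint of `a` and `b`;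
the parameter is clamped to `[0, 1]`. -/
noncomputable def halfEdge (a b : E) (t : ℝ) : E :=
  a + ((projIcc 0 1 zero_le_one t : ℝ) / 2) • (b - a)

theorem halfEdge_of_mem (a b : E) {t : ℝ} (ht : t ∈ Icc (0 : ℝ) 1) :
    halfEdge a b t = a + (t / 2) • (b - a) := by
  rw [halfEdge, projIcc_of_mem _ ht]

theorem halfEdge_mem_convexHull (a b : E) (t : ℝ) :
    halfEdge a b t ∈ convexHull ℝ ({a, b} : Set E) := by
  rw [convexHull_pair, segment_eq_image']
  have h := (projIcc (0 : ℝ) 1 zero_le_one t).2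
  exact ⟨_, ⟨by linarith [h.1], by linarith [h.2]⟩, rfl⟩

theorem lipschitzWith_halfEdge (a b : E) : LipschitzWith ‖b - a‖₊ (halfEdge a b) := by
  refine LipschitzWith.of_dist_le_mul fun s t => ?_
  have h : dist (projIcc (0 : ℝ) 1 zero_le_one s) (projIcc 0 1 zero_le_one t) ≤ dist s t := by
    simpa using (LipschitzWith.projIcc (zero_le_one (α := ℝ))).dist_le_mul s t
  rw [Subtype.dist_eq, Real.dist_eq] at h
  rw [halfEdge, halfEdge, dist_add_left, dist_eq_norm, ← sub_smul, ← sub_div, norm_smul,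
    Real.norm_eq_abs, abs_div, mul_comm, coe_nnnorm]
  refine mul_le_mul_of_nonneg_left ?_ (norm_nonneg _)
  rw [abs_two]
  linarith [abs_nonneg ((projIcc (0 : ℝ) 1 zero_le_one s : ℝ) - projIcc 0 1 zero_le_one t)]

theorem exists_halfEdge_eq {a b x : E} (hx : x ∈ convexHull ℝ ({a, b} : Set E)) :
    ∃ t ∈ Icc (0 : ℝ) 1, x = halfEdge a b t ∨ x = halfEdge b a t := by
  rw [convexHull_pair, segment_eq_image'] at hx
  obtain ⟨t, ⟨h0, h1⟩, rfl⟩ := hx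
  rcases le_total t (1 / 2) with h | h
  · refine ⟨2 * t, ⟨by linarith, by linarith⟩, Or.inl ?_⟩
    rw [halfEdge_of_mem _ _ ⟨by linarith, by linarith⟩]
    module
  · refine ⟨2 * (1 - t), ⟨by linarith, by linarith⟩, Or.inr ?_⟩
    rw [halfEdge_of_mem _ _ ⟨by linarith, by linarith⟩]
    module

theorem halfEdge_injOn {a b : E} (hab : a ≠ b) {s t : ℝ} (hs : s ∈ Icc (0 : ℝ) 1)
    (ht : t ∈ Icc (0 : ℝ) 1) (h : halfEdge a b s = halfEdge a b t) : s = t := by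
  rw [halfEdge_of_mem _ _ hs, halfEdge_of_mem _ _ ht] at h
  have := smul_left_injective ℝ (sub_ne_zero.2 hab.symm) (add_left_cancel h)
  linarith

theorem eq_one_of_halfEdge_eq_swap {a b : E} (hab : a ≠ b) {s t : ℝ} (hs : s ∈ Icc (0 : ℝ) 1)
    (ht : t ∈ Icc (0 : ℝ) 1) (h : halfEdge a b s = halfEdge b a t) : s = 1 ∧ t = 1 := by
  rw [halfEdge_of_mem _ _ hs, halfEdge_of_mem _ _ ht] at h
  have h' : (s / 2 + t / 2 - 1) • (b - a) = 0 := by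
    have := sub_eq_zero.2 h
    rw [← this]
    module
  have := (smul_eq_zero.1 h').resolve_right (sub_ne_zero.2 hab.symm)
  constructor <;> linarith [hs.2, ht.2]

theorem eq_zero_of_halfEdge_eq_endpoint {a b c : E} (hab : a ≠ b) {s : ℝ} (hs : s ∈ Icc (0 : ℝ) 1)
    (hc : c = a ∨ c = b) (h : halfEdge a b s = c) : s = 0 ∧ a = c := by
  rw [halfEdge_of_mem _ _ hs] at h
  rcases hc with rfl | rfl
  · have := (smul_eq_zero.1 (left_eq_add.1 h.symm)).resolve_right (sub_ne_zero.2 hab.symm)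
    exact ⟨by linarith, rfl⟩
  · have h' : (s / 2 - 1) • (c - a) = 0 := by
      have := sub_eq_zero.2 h
      rw [← this]
      module
    have := (smul_eq_zero.1 h').resolve_right (sub_ne_zero.2 hab.symm)
    linarith [hs.2]

/-- Two halves of one edge meet only at its midpoint, parameter `1`. Distinct edges meet in at most
one common vertex, parameter `0` on both halves. -/
theorem Geometry.SimplicialComplex.halfEdge_inj [DecidableEq E] (K : Geometry.SimplicialComplex ℝ E)
    {a b c d : E} (hab : a ≠ b) (hcd : c ≠ d) (habK : {a, b} ∈ K.faces) (hcdK : {c, d} ∈ K.faces)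
    {s t : ℝ} (hs : s ∈ Icc (0 : ℝ) 1) (ht : t ∈ Icc (0 : ℝ) 1)
    (h : halfEdge a b s = halfEdge c d t) :
    s = t ∧ ((a, b) = (c, d) ∨ s = 0 ∨ s = 1) := by
  by_cases h1 : a = c ∧ b = d
  · obtain ⟨rfl, rfl⟩ := h1
    exact ⟨halfEdge_injOn hab hs ht h, Or.inl rfl⟩
  by_cases h2 : a = d ∧ b = c
  · obtain ⟨rfl, rfl⟩ := h2
    obtain ⟨rfl, rfl⟩ := eq_one_of_halfEdge_eq_swap hab hs ht h
    exact ⟨rfl, Or.inr (Or.inr rfl)⟩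
  have hmem : halfEdge a b s ∈ convexHull ℝ (({a, b} : Set E) ∩ {c, d}) := by
    have := K.inter_subset_convexHull habK hcdK
      ⟨by simpa using halfEdge_mem_convexHull a b s,
        by rw [h]; simpa using halfEdge_mem_convexHull c d t⟩
    simpa using this
  obtain ⟨e, he⟩ := convexHull_nonempty_iff.1 ⟨_, hmem⟩
  have hsub : ({a, b} : Set E) ∩ {c, d} ⊆ {e} := by
    intro x hx
    simp only [mem_inter_iff, mem_insert_iff, mem_singleton_iff] at he hx ⊢
    grind
  have hval : halfEdge a b s = e := by
    simpa using convexHull_mono hsub hmem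
  obtain ⟨rfl, -⟩ := eq_zero_of_halfEdge_eq_endpoint hab hs he.1 hval
  obtain ⟨rfl, -⟩ := eq_zero_of_halfEdge_eq_endpoint hcd ht he.2 (h ▸ hval)
  exact ⟨rfl, Or.inr (Or.inl rfl)⟩

/-- The half edges of a connected one-dimensional complex decompose its space into arcs. -/
theorem Geometry.SimplicialComplex.exists_arcDecomposition
    (K : Geometry.SimplicialComplex ℝ E) (hfin : K.faces.Finite) (hcard : ∀ s ∈ K.faces, s.card ≤ 2)
    (hedge : ∃ s ∈ K.faces, s.card = 2) (hconn : IsConnected K.space) :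
    ∃ I : Set (E × E), I.Finite ∧ Nonempty (ArcDecomposition K.space I) := by
  classical
  -- Ordered pairs: each edge contributes two half edges, one from each endpoint.
  let I : Set (E × E) := {p | p.1 ≠ p.2 ∧ {p.1, p.2} ∈ K.faces}
  have hI : I.Finite := by
    refine (hfin.biUnion fun s _ => (s ×ˢ s).finite_toSet).subset ?_
    intro p hp
    exact mem_biUnion hp.2 (by simp)
  have hIf : Finite I := hI
  let _ := Fintype.ofFinite I
  have hmem : ∀ (j : I) (t : ℝ), halfEdge j.1.1 j.1.2 t ∈ K.space := fun j t =>
    convexHull_subset_space j.2.2 (by simpa using halfEdge_mem_convexHull j.1.1 j.1.2 t)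
  refine ⟨I, hI, ⟨⟨fun j t => ⟨halfEdge j.1.1 j.1.2 t, hmem j t⟩,
    ∑ j : I, ‖j.1.2 - j.1.1‖₊, fun j => ?_, ?_, ?_⟩⟩⟩
  · exact ((lipschitzWith_halfEdge _ _).weaken (Finset.single_le_sum
      (f := fun j : I => ‖j.1.2 - j.1.1‖₊) (fun _ _ => zero_le) (Finset.mem_univ j))).subtype_mk _
  · rintro ⟨x, hx⟩
    obtain ⟨s, hs, h2, hxs⟩ := K.exists_edge_of_mem_space hfin hcard hedge hconn hx
    obtain ⟨a, b, hab, rfl⟩ := Finset.card_eq_two.1 h2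
    obtain ⟨t, ht, h | h⟩ := exists_halfEdge_eq (a := a) (b := b) (by simpa using hxs)
    · exact ⟨⟨(a, b), hab, hs⟩, t, ht, Subtype.ext h.symm⟩
    · exact ⟨⟨(b, a), hab.symm, by rwa [Finset.pair_comm]⟩, t, ht, Subtype.ext h.symm⟩
  · intro j k s t hs ht h
    obtain ⟨hst, h' | h'⟩ := K.halfEdge_inj j.2.1 k.2.1 j.2.2 k.2.2 hs ht (Subtype.ext_iff.1 h)
    · exact ⟨hst, Or.inl (Subtype.ext h')⟩
    · exact ⟨hst, Or.inr h'⟩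

end ArcDecomposition

/-! ### Folding real functions into a graph, and steep zigzags -/

section Lifting

open scoped NNReal

namespace ArcDecomposition

variable {G J : Type*} [MetricSpace G] (D : ArcDecomposition G J)

/-- An arc containing the given point. -/
noncomputable def idx (p : G) : J := (D.surj p).choose

/-- The parameter of a point on every arc that contains it. -/
noncomputable def param (p : G) : ℝ := (D.surj p).choose_spec.choose

theorem param_mem (p : G) : D.param p ∈ Icc (0 : ℝ) 1 :=
  (D.surj p).choose_spec.choose_spec.1

@[simp]
theorem arc_idx_param (p : G) : D.arc (D.idx p) (D.param p) = p :=
  (D.surj p).choose_spec.choose_spec.2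

theorem param_arc (j : J) {t : ℝ} (ht : t ∈ Icc (0 : ℝ) 1) : D.param (D.arc j t) = t :=
  (D.inj (D.param_mem _) ht (D.arc_idx_param _)).1

theorem isClosed_image_arc (j : J) {S : Set ℝ} (hS : IsClosed S) :
    IsClosed (D.arc j '' (Icc 0 1 ∩ S)) :=
  ((isCompact_Icc.inter_right hS).image (D.lipschitz j).continuous).isClosed

theorem continuous_param [Finite J] : Continuous D.param := by
  refine continuous_iff_isClosed.2 fun S hS => ?_
  have : D.param ⁻¹' S = ⋃ j, D.arc j '' (Icc 0 1 ∩ S) := by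
    ext p
    simp only [mem_preimage, mem_iUnion, mem_image]
    constructor
    · intro hp
      exact ⟨D.idx p, D.param p, ⟨D.param_mem p, hp⟩, D.arc_idx_param p⟩
    · rintro ⟨j, t, ⟨ht, htS⟩, rfl⟩
      rwa [D.param_arc j ht]
  rw [this]
  exact isClosed_iUnion_of_finite fun j => D.isClosed_image_arc j hS

/-- A choice of one arc among all those having the same point at parameter `t` as `arc j`. -/
noncomputable def rep (t : ℝ) (j : J) : J :=
  @Classical.epsilon J ⟨j⟩ fun k => D.arc k t = D.arc j t

theorem arc_rep (t : ℝ) (j : J) : D.arc (D.rep t j) t = D.arc j t :=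
  Classical.epsilon_spec (p := fun k => D.arc k t = D.arc j t) ⟨j, rfl⟩

/-- The predicate behind the choice sees only the point `D.arc j t`, not the index `j`. -/
theorem rep_congr {t : ℝ} {j k : J} (h : D.arc j t = D.arc k t) : D.rep t j = D.rep t k := by
  simp only [rep, h]

/-- The arc `arc j`, continued at both of its ends along arcs that depend only on the endpoint. -/
noncomputable def foldArc (j : J) (s : ℝ) : G :=
  if s ≤ 0 then D.arc (D.rep 0 j) (-s) else if s ≤ 1 then D.arc j s else D.arc (D.rep 1 j) (2 - s)

theorem continuous_foldArc (j : J) : Continuous (D.foldArc j) := by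
  have h := fun j => (D.lipschitz j).continuous
  refine Continuous.if_le ((h _).comp continuous_neg) (Continuous.if_le (h _)
    ((h _).comp (continuous_const.sub continuous_id)) continuous_id continuous_const ?_)
    continuous_id continuous_const ?_
  · rintro s rfl
    norm_num [D.arc_rep]
  · rintro s rfl
    norm_num [D.arc_rep]

theorem dist_foldArc_le (j : J) {s t : ℝ} (ht : t ∈ Icc (0 : ℝ) 1) :
    dist (D.foldArc j s) (D.arc j t) ≤ D.const * |s - t| := by
  unfold foldArc
  split_ifs with h0 h1
  · refine (dist_triangle _ (D.arc (D.rep 0 j) 0) _).trans ?_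
    refine (add_le_add ((D.lipschitz _).dist_le_mul _ _) ((congrArg (dist · _)
      (D.arc_rep 0 j)).le.trans ((D.lipschitz _).dist_le_mul _ _))).trans ?_
    rw [← mul_add, Real.dist_eq, Real.dist_eq, sub_zero, zero_sub, abs_neg, abs_neg,
      abs_of_nonpos h0, abs_of_nonneg ht.1, abs_of_nonpos (by linarith [ht.1])]
    exact le_of_eq (by ring)
  · exact (D.lipschitz _).dist_le_mul _ _
  · push Not at h0 h1
    refine (dist_triangle _ (D.arc (D.rep 1 j) 1) _).trans ?_
    refine (add_le_add ((D.lipschitz _).dist_le_mul _ _) ((congrArg (dist · _)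
      (D.arc_rep 1 j)).le.trans ((D.lipschitz _).dist_le_mul _ _))).trans ?_
    rw [← mul_add, Real.dist_eq, Real.dist_eq, abs_of_nonpos (by linarith),
      abs_of_nonneg (by linarith [ht.2]), abs_of_nonneg (by linarith [ht.2])]
    exact le_of_eq (by ring)

theorem param_foldArc (j : J) {s : ℝ} (hs : s ∈ Icc (-1 : ℝ) 2) :
    D.param (D.foldArc j s) = -s ∨ D.param (D.foldArc j s) = s ∨
      D.param (D.foldArc j s) = 2 - s := by
  unfold foldArc
  split_ifs with h0 h1
  · exact Or.inl (D.param_arc _ ⟨by linarith, by linarith [hs.1]⟩)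
  · exact Or.inr (Or.inl (D.param_arc _ ⟨by linarith, h1⟩))
  · exact Or.inr (Or.inr (D.param_arc _ ⟨by linarith [hs.2], by linarith⟩))

/-- Small perturbations of a suitable real function of `f : X → G` are realized by perturbations
of `f`, so that the perturbed real function takes finitely many values on every fiber. -/
theorem exists_lift {G J : Type*} [MetricSpace G] [Finite J] (D : ArcDecomposition G J) {ε : ℝ} (hε : 0 < ε) (X : Type*) [TopologicalSpace X] :
    ∃ δ > 0, ∃ w : C(G, ℝ), ∀ (f : C(X, G)) (u : C(X, ℝ)), (∀ x, |u x - w (f x)| < δ) →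
      ∃ g : C(X, G), (∀ x, dist (g x) (f x) < ε) ∧
        ∀ y, ∃ F : Set ℝ, F.Finite ∧ ∀ x, g x = y → u x ∈ F := by
  have hC : (0 : ℝ) ≤ D.const := D.const.2
  -- The perturbed function will stay within `2 * δ` of the parameter: at most `1`, which keeps it
  -- in `[-1, 2]`, and small enough to move points by less than `ε`.
  obtain ⟨δ, hδ, hδ1, hδε⟩ : ∃ δ : ℝ, 0 < δ ∧ δ ≤ 1 / 2 ∧ D.const * (2 * δ) < ε := by
    have hpos : 0 < ε / (2 * (D.const + 1)) := by positivity
    refine ⟨min (1 / 2) (ε / (2 * (D.const + 1))), by positivity, min_le_left _ _, ?_⟩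
    have h2 : min (1 / 2) (ε / (2 * (D.const + 1))) ≤ ε / (2 * (D.const + 1)) := min_le_right _ _
    rw [le_div_iff₀ (by positivity)] at h2
    have h3 : (0 : ℝ) < min (1 / 2) (ε / (2 * (D.const + 1))) := by positivity
    linarith
  -- Stretching `[0, 1]` onto `[-δ, 1 + δ]` forces `u x < 0` or `u x > 1` wherever `f x` is an arc
  -- endpoint. There `foldArc` depends only on that endpoint, so the choice of arc is immaterial and
  -- the pieces glue continuously.
  refine ⟨δ, hδ, ⟨fun p => (1 + 2 * δ) * D.param p - δ,
    (continuous_const.mul D.continuous_param).sub continuous_const⟩, fun f u hu => ?_⟩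
  simp only [ContinuousMap.coe_mk] at hu
  have hbd : ∀ x, |u x - D.param (f x)| < 2 * δ := by
    intro x
    have h := abs_lt.1 (hu x)
    have ht := D.param_mem (f x)
    rw [abs_lt]
    constructor <;> nlinarith [ht.1, ht.2]
  have hval : ∀ j x, f x ∈ D.arc j '' (Icc 0 1 ∩ univ) →
      D.foldArc (D.idx (f x)) (u x) = D.foldArc j (u x) := by
    rintro j x ⟨t, ⟨ht, -⟩, hfx⟩
    have harc : D.arc (D.idx (f x)) (D.param (f x)) = D.arc j t := by simp [hfx]
    have hux := abs_lt.1 (hu x)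
    obtain ⟨hpt, h | h | h⟩ := D.inj (D.param_mem _) ht harc
    · rw [h]
    · rw [h] at hux
      rw [← hpt, h] at harc
      have h0 : u x ≤ 0 := by linarith
      simp only [foldArc, if_pos h0, D.rep_congr harc]
    · rw [h] at hux
      rw [← hpt, h] at harc
      have h1 : ¬ u x ≤ 1 := by linarith
      have h0 : ¬ u x ≤ 0 := by linarith
      simp only [foldArc, if_neg h0, if_neg h1, D.rep_congr harc]
  have hcont : Continuous fun x => D.foldArc (D.idx (f x)) (u x) := by
    refine (locallyFinite_of_finite fun j => f ⁻¹' (D.arc j '' (Icc 0 1 ∩ univ))).continuous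
      ?_ (fun j => (D.isClosed_image_arc j isClosed_univ).preimage f.continuous) fun j => ?_
    · refine eq_univ_of_forall fun x => mem_iUnion.2 ⟨D.idx (f x), D.param (f x), ?_, ?_⟩
      · exact ⟨D.param_mem _, mem_univ _⟩
      · simp
    · exact ((D.continuous_foldArc j).comp u.continuous).continuousOn.congr fun x hx => hval j x hx
  refine ⟨⟨_, hcont⟩, fun x => ?_, fun y => ?_⟩
  · have h := D.dist_foldArc_le (D.idx (f x)) (s := u x) (D.param_mem (f x))
    rw [D.arc_idx_param] at h
    exact (h.trans (mul_le_mul_of_nonneg_left (hbd x).le hC)).trans_lt hδε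
  · refine ⟨{-D.param y, D.param y, 2 - D.param y}, by simp, fun x hx => ?_⟩
    have hx' := abs_lt.1 (hbd x)
    have ht := D.param_mem (f x)
    have := D.param_foldArc (D.idx (f x)) (s := u x)
      ⟨by linarith [ht.1], by linarith [ht.2]⟩
    rw [show D.foldArc (D.idx (f x)) (u x) = y from hx] at this
    simp only [mem_insert_iff, mem_singleton_iff]
    rcases this with h | h | h
    · left; linarith
    · right; left; linarith
    · right; right; linarith

end ArcDecomposition

/-- Distance to the nearest integer is a zigzag of slope `±1`, linear on each half-unit interval;
`⌊2 * x⌋` indexes the interval. -/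
theorem abs_norm_unitAddCircle_sub {x y : ℝ} (h : ⌊2 * x⌋ = ⌊2 * y⌋) :
    |‖(x : UnitAddCircle)‖ - ‖(y : UnitAddCircle)‖| = |x - y| := by
  have key : ∀ {z : ℝ} {k : ℤ}, ⌊2 * z⌋ = k →
      ‖(z : UnitAddCircle)‖ = if Even k then z - k / 2 else (k + 1) / 2 - z := by
    intro z k hk
    obtain ⟨h1, h2⟩ := Int.floor_eq_iff.1 hk
    rw [UnitAddCircle.norm_eq, round_eq]
    split_ifs with he
    · obtain ⟨m, rfl⟩ := he
      push_cast at *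
      have : ⌊z + 1 / 2⌋ = m := Int.floor_eq_iff.2 ⟨by linarith, by linarith⟩
      rw [this, abs_of_nonneg (by linarith)]
      ring
    · obtain ⟨m, rfl⟩ := Int.not_even_iff_odd.1 he
      push_cast at *
      have : ⌊z + 1 / 2⌋ = m + 1 := Int.floor_eq_iff.2
        ⟨by push_cast; linarith, by push_cast; linarith⟩
      rw [this, abs_of_nonpos (by push_cast; linarith)]
      push_cast
      ring
  rw [key rfl, key h.symm]
  split_ifs
  · ring_nf
  · rw [abs_sub_comm]
    ring_nf

/-- There are arbitrarily small real functions that expand distances by an arbitrarily large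
factor on each of finitely many pieces. -/
theorem ArcDecomposition.exists_small_piecewise_expanding {G J : Type*} [MetricSpace G] [Finite J]
    (D : ArcDecomposition G J) (M : ℝ≥0) {η : ℝ} (hη : 0 < η) :
    ∃ w : C(G, ℝ), (∀ p, |w p| ≤ η) ∧ ∃ κ : G → J × ℤ, (range κ).Finite ∧
      ∀ p q, κ p = κ q → M * dist p q ≤ |w p - w q| := by
  -- The zigzag of height `η` and frequency `b` has slope `2 * η * b = M * D.const` in the
  -- parameter; the factor `D.const` pays for the Lipschitz arcs.
  let b : ℝ := M * D.const / (2 * η)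
  have hb : 0 ≤ b := by positivity
  refine ⟨⟨fun p => 2 * η * ‖((b * D.param p : ℝ) : UnitAddCircle)‖, ?_⟩, fun p => ?_,
    fun p => (D.idx p, ⌊2 * (b * D.param p)⌋), ?_, fun p q h => ?_⟩
  · exact continuous_const.mul (((AddCircle.continuous_mk' 1).comp
      (continuous_const.mul D.continuous_param)).norm)
  · have h1 : ‖((b * D.param p : ℝ) : UnitAddCircle)‖ ≤ 1 / 2 := by
      rw [UnitAddCircle.norm_eq]
      exact abs_sub_round _
    simp only [ContinuousMap.coe_mk]
    rw [abs_of_nonneg (by positivity)]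
    nlinarith
  · refine (finite_univ.prod (finite_Icc (0 : ℤ) ⌊2 * b⌋)).subset ?_
    rintro _ ⟨p, rfl⟩
    have ht := D.param_mem p
    refine ⟨mem_univ _, Int.floor_nonneg.2 (by have := ht.1; positivity), Int.floor_le_floor ?_⟩
    nlinarith [ht.2]
  · obtain ⟨hj, hk⟩ := Prod.mk.inj h
    simp only [ContinuousMap.coe_mk]
    rw [← mul_sub, abs_mul, abs_norm_unitAddCircle_sub hk, ← mul_sub, abs_mul b, abs_of_nonneg hb,
      abs_of_pos (by positivity : 0 < 2 * η), ← mul_assoc]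
    have hd := (D.lipschitz (D.idx p)).dist_le_mul (D.param p) (D.param q)
    rw [D.arc_idx_param, hj, D.arc_idx_param, Real.dist_eq] at hd
    have hab : 2 * η * b = M * D.const := by
      simp only [b]
      field_simp
    rw [hab, mul_assoc]
    exact mul_le_mul_of_nonneg_left hd M.2

end Lifting

/-! ### Density of maps with finite fibers -/

section Density

open scoped NNReal

/-- On a compact metric space Lipschitz functions are uniformly dense in continuous functions. -/
theorem ContinuousMap.exists_lipschitzWith_near {X : Type*} [MetricSpace X] [CompactSpace X]
    (f : C(X, ℝ)) {ε : ℝ} (hε : 0 < ε) :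
    ∃ (L : ℝ≥0) (g : C(X, ℝ)), LipschitzWith L g ∧ ∀ x, |g x - f x| < ε := by
  -- Stone–Weierstrass for the algebra of Lipschitz functions; products stay Lipschitz because the
  -- factors are bounded.
  let A : Subalgebra ℝ C(X, ℝ) :=
    { carrier := {g | ∃ L : ℝ≥0, LipschitzWith L g}
      mul_mem' := by
        rintro g h ⟨L, hg⟩ ⟨M, hh⟩
        refine ⟨‖g‖₊ * M + ‖h‖₊ * L, LipschitzWith.of_dist_le_mul fun x y => ?_⟩
        have e : g x * h x - g y * h y = g x * (h x - h y) + h y * (g x - g y) := by ring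
        have h1 := hg.dist_le_mul x y
        have h2 := hh.dist_le_mul x y
        rw [Real.dist_eq] at h1 h2 ⊢
        simp only [ContinuousMap.mul_apply]
        rw [e]
        refine (abs_add_le _ _).trans ?_
        rw [abs_mul, abs_mul]
        push_cast
        rw [add_mul, mul_assoc, mul_assoc]
        exact add_le_add
          (mul_le_mul (g.norm_coe_le_norm x) h2 (abs_nonneg _) (norm_nonneg _))
          (mul_le_mul (h.norm_coe_le_norm y) h1 (abs_nonneg _) (norm_nonneg _))
      add_mem' := by
        rintro g h ⟨L, hg⟩ ⟨M, hh⟩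
        exact ⟨L + M, hg.add hh⟩
      algebraMap_mem' := fun r => ⟨0, LipschitzWith.const r⟩ }
  have hA : A.SeparatesPoints := by
    intro x y hxy
    refine ⟨fun z => dist z x, ⟨⟨fun z => dist z x, by fun_prop⟩,
      ⟨1, LipschitzWith.dist_left x⟩, rfl⟩, ?_⟩
    simpa using hxy.symm
  obtain ⟨⟨g, L, hL⟩, hg⟩ :=
    ContinuousMap.exists_mem_subalgebra_near_continuous_of_separatesPoints A hA f f.continuous ε hε
  exact ⟨L, g, hL, hg⟩

variable {ι : Type*} [Fintype ι] {G J : ι → Type*} [∀ i, MetricSpace (G i)]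
  [∀ i, CompactSpace (G i)] [∀ i, Finite (J i)]

/-- Families of real functions on a product of spaces with arc decompositions can be perturbed so
as to have finite fibers. -/
theorem exists_finite_fibers_near (D : ∀ i, ArcDecomposition (G i) (J i))
    (v : ι → C(∀ i, G i, ℝ)) {δ : ι → ℝ} (hδ : ∀ i, 0 < δ i) :
    ∃ u : ι → C(∀ i, G i, ℝ), (∀ i x, |u i x - v i x| < δ i) ∧
      ∀ c : ι → ℝ, {x | ∀ i, u i x = c i}.Finite := by
  choose L l hL hl using fun i => (v i).exists_lipschitzWith_near (half_pos (hδ i))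
  -- The expansion factor `L i + 1` beats the Lipschitz constant of `l i`.
  choose w hw κ hκ hexp using fun i =>
    (D i).exists_small_piecewise_expanding (L i + 1) (half_pos (half_pos (hδ i)))
  refine ⟨fun i => l i + (w i).comp ⟨fun x => x i, continuous_apply i⟩, fun i x => ?_,
    fun c => ?_⟩
  · have h1 := hl i x
    have h2 := hw i (x i)
    have h3 := hδ i
    simp only [ContinuousMap.add_apply, ContinuousMap.comp_apply, ContinuousMap.coe_mk]
    rw [abs_lt] at h1 ⊢
    rw [abs_le] at h2
    constructor <;> linarith
  -- The finitely valued piece labels `κ` are injective on a joint fiber. Otherwise each coordinate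
  -- distance would be smaller than `dist x y`, which is impossible for the sup metric.
  · refine Set.Finite.of_finite_image (f := fun x i => κ i (x i))
      ((Set.Finite.pi' hκ).subset ?_) ?_
    · rintro _ ⟨x, -, rfl⟩ i
      exact mem_range_self _
    · intro x hx y hy hxy
      by_contra hne
      have hpos : 0 < dist x y := dist_pos.2 hne
      refine lt_irrefl (dist x y) ((dist_pi_lt_iff hpos).2 fun i => ?_)
      have hx' := hx i
      have hy' := hy i
      simp only [ContinuousMap.add_apply, ContinuousMap.comp_apply, ContinuousMap.coe_mk]
        at hx' hy'
      have h1 := hexp i (x i) (y i) (congrFun hxy i)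
      have h2 := (hL i).dist_le_mul x y
      rw [Real.dist_eq] at h2
      have h3 : w i (x i) - w i (y i) = -(l i x - l i y) := by linarith
      rw [h3, abs_neg] at h1
      push_cast at h1
      by_contra hle
      push Not at hle
      nlinarith [mul_le_mul_of_nonneg_left hle (L i).2, (L i).2]

/-- Maps with finite fibers are dense among the self-maps of a finite product of compact spaces
with arc decompositions. -/
theorem dense_setOf_finite_fibers (D : ∀ i, ArcDecomposition (G i) (J i)) :
    Dense {f : C(∀ i, G i, ∀ i, G i) | ∀ y, (f ⁻¹' {y}).Finite} := by
  refine Metric.dense_iff.2 fun f ε hε => ?_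
  choose δ hδ w hw using fun i => (D i).exists_lift hε (∀ i, G i)
  let f' : ∀ i, C(∀ i, G i, G i) := fun i => ⟨fun x => f x i, by fun_prop⟩
  obtain ⟨u, hu, hfin⟩ := exists_finite_fibers_near D (fun i => (w i).comp (f' i)) hδ
  choose g hg hF using fun i => hw i (f' i) (u i) (hu i)
  refine ⟨⟨fun x i => g i x, by fun_prop⟩, ?_, fun y => ?_⟩
  · rw [Metric.mem_ball, ContinuousMap.dist_lt_iff hε]
    intro x
    exact (dist_pi_lt_iff hε).2 fun i => hg i x
  · choose F hFf hFu using fun i => hF i (y i)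
    -- The fiber lies in a finite union of joint fibers of `u`, one for each choice of values in the
    -- sets `F i`.
    refine ((Set.Finite.pi' hFf).biUnion fun c _ => hfin c).subset fun x hx => ?_
    exact mem_biUnion (x := fun i => u i x)
      (fun i => hFu i x (congrFun (show (fun i => g i x) = y from hx) i)) fun i => rfl

end Density

/-! ### Transport along homeomorphisms and conclusion -/

/-- Density of maps with finite fibers is a topological property. -/
theorem Homeomorph.dense_setOf_finite_fibers {X Y : Type*} [TopologicalSpace X]
    [TopologicalSpace Y] (e : X ≃ₜ Y) (h : Dense {f : C(Y, Y) | ∀ y, (f ⁻¹' {y}).Finite}) :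
    Dense {f : C(X, X) | ∀ x, (f ⁻¹' {x}).Finite} := by
  -- Conjugation by `e` is a homeomorphism of mapping spaces, and preimages of dense sets under open
  -- maps are dense.
  refine (h.preimage (e.arrowCongr e).isOpenMap).mono fun f hf x => ?_
  refine Set.Finite.of_finite_image ((hf (e x)).subset ?_) e.injective.injOn
  rintro _ ⟨z, hz, rfl⟩
  have hz' : f z = x := hz
  show e (f (e.symm (e z))) = e x
  rw [e.symm_apply_apply, hz']

theorem Geometry.SimplicialComplex.isCompact_space {E : Type*} [NormedAddCommGroup E]
    [NormedSpace ℝ E] (K : Geometry.SimplicialComplex ℝ E) (hfin : K.faces.Finite) :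
    IsCompact K.space :=
  hfin.isCompact_biUnion fun s _ => s.finite_toSet.isCompact_convexHull ℝ

theorem theorem8p3 (n : ℕ) (G : Fin n → Type*) [∀ i, TopologicalSpace (G i)]
    (hG : ∀ i, IsGraphSpace (G i)) :
    ZeroDIM (∀ i, G i) := by
  choose N K hfin hcard hedge hconn e using hG
  have e' : ∀ i, G i ≃ₜ (K i).space := fun i => (e i).some
  have hc : ∀ i, CompactSpace (K i).space := fun i =>
    isCompact_iff_compactSpace.1 ((K i).isCompact_space (hfin i))
  choose I hI D using fun i =>
    (K i).exists_arcDecomposition (hfin i) (hcard i) (hedge i) (hconn i)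
  have hIf : ∀ i, Finite (I i) := hI
  let h : (∀ i, G i) ≃ₜ ∀ i, (K i).space := Homeomorph.piCongrRight e'
  have hcompact : CompactSpace (∀ i, G i) := h.symm.compactSpace
  have hmetr : MetrizableSpace (∀ i, G i) := h.isEmbedding.metrizableSpace
  have hsc : SecondCountableTopology (∀ i, G i) := h.isEmbedding.secondCountableTopology
  exact ⟨hcompact, hmetr, isGδ_setOf_isDimensionalMap_zero,
    (h.dense_setOf_finite_fibers (dense_setOf_finite_fibers fun i => (D i).some)).mono
      fun f hf => isDimensionalMap_zero_of_finite_fibers f hf⟩
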